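/- Let $k\ge 2$, let $H=(V,E)$ be a finite $k$-uniform hypergraph without multiple edges (so $E$ is a set of $k$-element subsets of the finite set $V$) in which every vertex lies in at most $\Delta$ edges, and let \[ I=I(H)=\{|P\setminus Q| : P,Q\in E\}\cap\{1,\dots,k-1\}. \] Let every vertex $v\in V$ be given a list $L_v$ of at least $R$ colors (natural numbers), where $R\in\mathbb{N}$. Put $q_1=1$ and $q_i=\frac{i}{i-1}\sqrt[i]{i-1}$ for $i>1$, and let $f_i$ be the Fubini number, i.e. the number of total preorders of $\{1,\dots,i\}$. (a) If \[ R\ \ge\ \left\lceil 2+\sum_{i\in I} q_i\sqrt[i]{\frac{\Delta(\Delta-1)(k-1)}{k-i}\,2^{\,k-i+1}f_i}\,\right\rceil , \] then there is a coloring $\varphi\colon V\to\mathbb{N}$ with $\varphi(v)\in L_v$ for every $v\in V$ such that for any two distinct intersecting edges $P,Q\in E$ the sets of colors $\varphi(P)$ and $\varphi(Q)$ are different. (b) If \[ R\ \ge\ \left\lceil 2+\sum_{i\in I} q_i\sqrt[i]{\frac{\Delta(\Delta-1)(k-1)}{k-i}\,i!}\,\right\rceil , \] then there is a coloring $\varphi\colon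 V\to\mathbb{N}$ with $\varphi(v)\in L_v$ for every $v\in V$ such that for any two distinct intersecting edges $P,Q\in E$ the multisets of colors appearing on $P$ and on $Q$ are different. -/

import Mathlib

noncomputable section

namespace Hypergraph

variable {V : Type*}

/-- A hypergraph is `k`-uniform if each of its edges has exactly `k` elements. -/
def IsUniformHypergraph (H : Hypergraph V) (k : ℕ) : Prop :=
  ∀ P ∈ H.edgeSet, P.encard = k

/-- The degree of a vertex: the number of edges containing it. -/
def vertexDegree (H : Hypergraph V) (v : V) : ℕ∞ :=
  {P : Set V | P ∈ H.edgeSet ∧ v ∈ P}.encard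

/-- The maximum degree of a hypergraph. -/
def maxVertexDegree (H : Hypergraph V) : ℕ∞ :=
  ⨆ v ∈ H.vertexSet, H.vertexDegree v

open Classical in
/-- `I(H)`, the set of the integers `1 ≤ i ≤ k - 1` of the form `|P \ Q|` with `P`, `Q` edges. -/
def diffSizes (H : Hypergraph V) (k : ℕ) : Finset ℕ :=
  {i ∈ Finset.Icc 1 (k - 1) | ∃ P ∈ H.edgeSet, ∃ Q ∈ H.edgeSet, (P \ Q).encard = i}

/-- `φ` distinguishes intersecting edges by sets: any two distinct intersecting edges have
different sets of colors. -/
def IsIedsColoring (H : Hypergraph V) (φ : V → ℕ) : Prop :=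
  ∀ P ∈ H.edgeSet, ∀ Q ∈ H.edgeSet, P ≠ Q → (P ∩ Q).Nonempty → φ '' P ≠ φ '' Q

/-- `φ` distinguishes intersecting edges by multisets: any two distinct intersecting edges have
different multisets of colors. For hypergraphs whose edges are finite; an edge is presented by
the finset of its elements, so that the multiset of its colors is `P.val.map φ`. -/
def IsIedmColoring (H : Hypergraph V) (φ : V → ℕ) : Prop :=
  ∀ P Q : Finset V, (P : Set V) ∈ H.edgeSet → (Q : Set V) ∈ H.edgeSet → P ≠ Q →
    ((P : Set V) ∩ (Q : Set V)).Nonempty → P.val.map φ ≠ Q.val.map φ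

/-- `φ` takes the color of each vertex from the list of that vertex. -/
def RespectsLists (H : Hypergraph V) (L : V → Finset ℕ) (φ : V → ℕ) : Prop :=
  ∀ v ∈ H.vertexSet, φ v ∈ L v

end Hypergraph

/-- The Fubini number: the number of total preorders of an `n`-element set. -/
def fubiniNumber (n : ℕ) : ℕ :=
  Nat.card {r : Fin n → Fin n → Prop // IsPreorder (Fin n) r ∧ Std.Total r}

/-- The `i`-th root of a nonnegative real number, for `i ≥ 1`. -/
def ithRoot (i : ℕ) (x : ℝ) : ℝ := x ^ (1 / (i : ℝ))

/-- `q 1 = 1` and `q i = (i / (i - 1)) * (i - 1) ^ (1 / i)` for `i > 1`. -/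
def qConst (i : ℕ) : ℝ :=
  if i = 1 then 1 else (i : ℝ) / ((i : ℝ) - 1) * ithRoot i ((i : ℝ) - 1)

end

/-!
The existence of the colorings follows from a counting argument. Call a coloring of a set `S` of
vertices good if it has no conflict between two edges whose symmetric difference lies in `S`, and
let `C S` be the number of good list colorings of `S`. For a suitable real `β ≥ 1`, induction on
`S` shows `C (insert v S) ≥ β * C S`, so that `C` of the whole vertex set is positive. Among the at
least `R * C S` extensions of good colorings to `v`, a bad one has a conflict between two edges
`P` and `Q`. Given a short code, the colors of some `i = #(P \ Q)` vertices, `v` among them, can be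
recovered from the other colors, which form a good coloring of a set smaller than `S` by `i - 1`
elements. By induction there are at most `β ^ (1 - i) * C S` of these, so the induction goes through
if `β + ∑ i, N i * β ^ (1 - i) ≤ R`, with `N i` the number of codes for conflicts of size `i` at a
vertex (`exists_good_listColoring`, `exists_good_listColoring_of_pairs`). Taking `β` to be one plus
the sum of the minimizers `((i - 1) * N i) ^ (1 / i)` of `b + N i * b ^ (1 - i)`, whose minima are
`q i * N i ^ (1 / i)`, gives the bounds on `R` (`exists_growth_factor`).

The number of pairs `(P, Q)` with `v ∈ P \ Q` and `#(P \ Q) = i` is bounded by double counting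
(`card_pairs_mem_sdiff_le`). For multisets, the colors on `P \ Q` are a rearrangement of those on
`Q \ P`, which gives `i!` codes (`exists_multisetGood`). For sets, the colors on `P \ Q` are given by
a total preorder of `P \ Q` and by the set of colors used, and the latter is known from `Q` up to
the choice of a set of vertices of `P ∩ Q`. Here the color of `v ∈ P ∩ Q` may also complete a
conflict. It is then the only color by which the colored parts of `P` and `Q` differed, so, up to
exchanging `P` and `Q`, it occurs on `P \ Q`. Moving this color to the bottom of the order singles
out a vertex of `P \ Q` with the color of `v`, which may be kept in exchange for `v`, so that again
`i` colors are recovered (`IsSetCode.eq_on_recoveredSet`, `exists_setGood`).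
-/

open Finset

/-! ### The counting method for list colorings -/

/-- The `L`-colorings of `S` satisfying `Good S`, each extended by the color `0` outside `S`. -/
noncomputable def goodColorings {V : Type*} (L : V → Finset ℕ) (Good : Finset V → (V → ℕ) → Prop)
    (S : Finset V) : Finset (V → ℕ) := by
  classical
  exact {φ ∈ (S.pi L).image (fun f v => if h : v ∈ S then f v h else 0) | Good S φ}

theorem mem_goodColorings {V : Type*} {L : V → Finset ℕ} {Good : Finset V → (V → ℕ) → Prop}
    {S : Finset V} {φ : V → ℕ} :
    φ ∈ goodColorings L Good S ↔ (∀ v ∈ S, φ v ∈ L v) ∧ (∀ v ∉ S, φ v = 0) ∧ Good S φ := by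
  classical
  simp only [goodColorings, mem_filter, mem_image, mem_pi]
  constructor
  · rintro ⟨⟨f, hf, rfl⟩, hg⟩
    refine ⟨fun v hv => ?_, fun v hv => ?_, hg⟩
    · simpa [hv] using hf v hv
    · simp [hv]
  · rintro ⟨h1, h2, h3⟩
    refine ⟨⟨fun v _ => φ v, h1, ?_⟩, h3⟩
    funext v
    by_cases hv : v ∈ S <;> simp [hv, h2]

/-- The counting step: if every good coloring of `S` loses its goodness in few extensions to `v`,
then the number of good colorings grows by the factor `β`. A bad extension `φ` is recovered from
its code `e φ` and its values outside the set `T (e φ)`, and these values form a good coloring of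
`S \ T (e φ)`, of which `hgrow` says there are few. -/
theorem card_goodColorings_insert {V ι : Type*} [DecidableEq V]
    (L : V → Finset ℕ) (R : ℕ) (Good : Finset V → (V → ℕ) → Prop)
    (hlocal : ∀ S φ ψ, (∀ v ∈ S, φ v = ψ v) → Good S φ → Good S ψ)
    (hmono : ∀ S S' φ, S' ⊆ S → Good S φ → Good S' φ)
    (β : ℝ) (hβ : 0 < β) (S : Finset V) (v : V) (hv : v ∉ S) (hLv : R ≤ #(L v))
    (J : Finset ι) (T : ι → Finset V)
    (hsum : β + ∑ j ∈ J, (β ^ (#(T j) - 1))⁻¹ ≤ R)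
    (hT : ∀ j ∈ J, v ∈ T j)
    (e : (V → ℕ) → ι)
    (he : ∀ φ, Good S φ → ¬ Good (insert v S) φ → e φ ∈ J ∧ T (e φ) ⊆ insert v S)
    (hinj : ∀ φ ψ, Good S φ → ¬ Good (insert v S) φ → Good S ψ → ¬ Good (insert v S) ψ →
      e φ = e ψ → (∀ x ∈ S \ T (e φ), φ x = ψ x) → ∀ x ∈ T (e φ), φ x = ψ x)
    (hgrow : ∀ S' ⊆ S, β ^ #(S \ S') * #(goodColorings L Good S') ≤ #(goodColorings L Good S)) :
    β * #(goodColorings L Good S) ≤ #(goodColorings L Good (insert v S)) := by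
  classical
  set C := goodColorings L Good with hC
  -- all extensions of good colorings of `S`
  set A : Finset (V → ℕ) := goodColorings L (fun _ φ => Good S φ) (insert v S) with hA
  have hext : ∀ φ ∈ C S, ∀ c, Good S (Function.update φ v c) := fun φ hφ c =>
    hlocal S φ _ (fun x hx => (Function.update_of_ne (ne_of_mem_of_not_mem hx hv) _ _).symm)
      (mem_goodColorings.1 hφ).2.2
  have hAcard : R * #(C S) ≤ #A := by
    calc R * #(C S) ≤ #(L v) * #(C S) := Nat.mul_le_mul_right _ hLv
      _ = #(C S ×ˢ L v) := by rw [card_product, mul_comm]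
      _ ≤ #A := by
        refine card_le_card_of_injOn (fun p => Function.update p.1 v p.2) ?_ ?_
        · rintro ⟨φ, c⟩ hp
          simp only [coe_product, Set.mem_prod, mem_coe] at hp
          have h := mem_goodColorings.1 hp.1
          refine mem_coe.2 (mem_goodColorings.2 ⟨fun x hx => ?_, fun x hx => ?_, hext φ hp.1 c⟩)
          · by_cases hxv : x = v
            · subst hxv; simpa using hp.2
            · simpa [hxv] using h.1 x ((mem_insert.1 hx).resolve_left hxv)
          · rw [mem_insert, not_or] at hx
            simpa [hx.1] using h.2.1 x hx.2
        · rintro ⟨φ, c⟩ hp ⟨ψ, d⟩ hq hpq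
          simp only [coe_product, Set.mem_prod, mem_coe] at hp hq
          have hx : ∀ x, Function.update φ v c x = Function.update ψ v d x := congrFun hpq
          have hcd : c = d := by simpa using hx v
          refine Prod.ext (funext fun x => ?_) hcd
          by_cases hxv : x = v
          · subst hxv
            exact ((mem_goodColorings.1 hp.1).2.1 x hv).trans
              ((mem_goodColorings.1 hq.1).2.1 x hv).symm
          · simpa [hxv] using hx x
  have hsplit : #A ≤ #(C (insert v S)) + #{φ ∈ A | ¬ Good (insert v S) φ} := by
    rw [← card_filter_add_card_filter_not (s := A) (fun φ => Good (insert v S) φ)]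
    gcongr
    intro φ hφ
    rw [mem_filter] at hφ
    have h := mem_goodColorings.1 hφ.1
    exact mem_goodColorings.2 ⟨h.1, h.2.1, hφ.2⟩
  have hfib : ∀ j ∈ J, (#{φ ∈ A | ¬ Good (insert v S) φ ∧ e φ = j} : ℝ) ≤
      (β ^ (#(T j) - 1))⁻¹ * #(C S) := by
    intro j hj
    rcases Finset.eq_empty_or_nonempty {φ ∈ A | ¬ Good (insert v S) φ ∧ e φ = j} with h0 | ⟨φ₀, hφ₀⟩
    · rw [h0]; simp; positivity
    have hTS : T j ⊆ insert v S := by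
      obtain ⟨h1, h2, h3⟩ := mem_filter.1 hφ₀
      exact h3 ▸ (he φ₀ (mem_goodColorings.1 h1).2.2 h2).2
    have h1 : #{φ ∈ A | ¬ Good (insert v S) φ ∧ e φ = j} ≤ #(C (S \ T j)) := by
      refine card_le_card_of_injOn (fun φ => (S \ T j).piecewise φ 0) ?_ ?_
      · intro φ hφ
        have h := mem_goodColorings.1 (mem_filter.1 (mem_coe.1 hφ)).1
        refine mem_coe.2 (mem_goodColorings.2 ⟨fun x hx => ?_, fun x hx => ?_, ?_⟩)
        · simp only [piecewise_eq_of_mem _ _ _ hx]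
          exact h.1 x (mem_insert_of_mem (mem_sdiff.1 hx).1)
        · simp only [piecewise_eq_of_notMem _ _ _ hx, Pi.zero_apply]
        · exact hlocal _ φ _ (fun x hx => (piecewise_eq_of_mem _ _ _ hx).symm)
            (hmono S _ φ sdiff_subset h.2.2)
      · intro φ hφ ψ hψ hφψ
        obtain ⟨a1, a2, a3⟩ := mem_filter.1 (mem_coe.1 hφ)
        obtain ⟨b1, b2, b3⟩ := mem_filter.1 (mem_coe.1 hψ)
        have ha := mem_goodColorings.1 a1
        have hb := mem_goodColorings.1 b1
        have hout : ∀ x ∈ S \ T (e φ), φ x = ψ x := by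
          intro x hx
          rw [a3] at hx
          have := congrFun hφψ x
          simpa only [piecewise_eq_of_mem _ _ _ hx] using this
        have hin := hinj φ ψ ha.2.2 a2 hb.2.2 b2 (a3.trans b3.symm) hout
        funext x
        by_cases hxT : x ∈ T (e φ)
        · exact hin x hxT
        by_cases hxS : x ∈ S
        · exact hout x (mem_sdiff.2 ⟨hxS, hxT⟩)
        · have hxv : x ∉ insert v S := by
            rw [mem_insert, not_or]
            refine ⟨fun h => hxT ?_, hxS⟩
            rw [h, a3]; exact hT j hj
          rw [ha.2.1 x hxv, hb.2.1 x hxv]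
    have hcard : #(S \ (S \ T j)) = #(T j) - 1 := by
      rw [sdiff_sdiff_right_self, inf_eq_inter, ← card_erase_of_mem (hT j hj)]
      congr 1
      ext x
      simp only [mem_inter, mem_erase]
      refine ⟨fun h => ⟨ne_of_mem_of_not_mem h.1 hv, h.2⟩, fun h => ⟨?_, h.2⟩⟩
      exact (mem_insert.1 (hTS h.2)).resolve_left h.1
    have h2 := hgrow (S \ T j) sdiff_subset
    rw [hcard] at h2
    calc (#{φ ∈ A | ¬ Good (insert v S) φ ∧ e φ = j} : ℝ) ≤ #(C (S \ T j)) := by exact_mod_cast h1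
      _ ≤ (β ^ (#(T j) - 1))⁻¹ * #(C S) := by
        rw [inv_mul_eq_div, le_div_iff₀ (by positivity), mul_comm]
        exact h2
  have hbad : (#{φ ∈ A | ¬ Good (insert v S) φ} : ℝ) ≤
      (∑ j ∈ J, (β ^ (#(T j) - 1))⁻¹) * #(C S) := by
    have hmaps : ∀ φ ∈ ({φ ∈ A | ¬ Good (insert v S) φ} : Finset _), e φ ∈ J := fun φ hφ =>
      (he φ (mem_goodColorings.1 (mem_filter.1 hφ).1).2.2 (mem_filter.1 hφ).2).1
    rw [card_eq_sum_card_fiberwise hmaps, sum_mul]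
    push_cast
    refine sum_le_sum fun j hj => ?_
    rw [filter_filter]
    exact hfib j hj
  have hA' : (R : ℝ) * #(C S) ≤ #A := by exact_mod_cast hAcard
  have hs' : (#A : ℝ) ≤ #(C (insert v S)) + #{φ ∈ A | ¬ Good (insert v S) φ} := by
    exact_mod_cast hsplit
  have := mul_le_mul_of_nonneg_right hsum (Nat.cast_nonneg (α := ℝ) #(C S))
  rw [add_mul] at this
  linarith

/-- Iterating the growth by the factor `β` one vertex at a time. -/
theorem pow_mul_card_goodColorings_le {V : Type*} [DecidableEq V] {L : V → Finset ℕ}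
    {Good : Finset V → (V → ℕ) → Prop} {β : ℝ} (hβ : 0 < β) (n : ℕ) (W : Finset V)
    (h : ∀ S ⊆ W, #S < n → ∀ v ∈ W, v ∉ S →
      β * #(goodColorings L Good S) ≤ #(goodColorings L Good (insert v S)))
    (S : Finset V) (hSW : S ⊆ W) (hn : #S ≤ n) (S' : Finset V) (hS' : S' ⊆ S) :
    β ^ #(S \ S') * #(goodColorings L Good S') ≤ #(goodColorings L Good S) := by
  induction hm : #(S \ S') generalizing S with
  | zero =>
    have : S = S' := (sdiff_eq_empty_iff_subset.1 (card_eq_zero.1 hm)).antisymm hS'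
    simp [this]
  | succ m ih =>
    obtain ⟨v, hv⟩ : (S \ S').Nonempty := card_pos.1 (by omega)
    obtain ⟨hvS, hvS'⟩ := mem_sdiff.1 hv
    have hlt := card_erase_lt_of_mem hvS
    have h1 := ih (S.erase v) ((erase_subset _ _).trans hSW) (by omega)
      (subset_erase.2 ⟨hS', hvS'⟩) (by rw [erase_sdiff_comm, card_erase_of_mem hv, hm]; rfl)
    have h2 := h (S.erase v) ((erase_subset _ _).trans hSW) (by omega) v (hSW hvS)
      (notMem_erase v S)
    rw [insert_erase hvS] at h2
    calc β ^ (m + 1) * #(goodColorings L Good S')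
        = β * (β ^ m * #(goodColorings L Good S')) := by ring
      _ ≤ β * #(goodColorings L Good (S.erase v)) := by gcongr
      _ ≤ _ := h2

/-- The counting method for list colorings: a coloring good on all of `W` exists as soon as, for
each vertex `v`, the extensions to `v` that destroy goodness can be encoded by codes `j ∈ J v` so
cheaply that `β + ∑ j ∈ J v, β ^ (1 - #(T v j)) ≤ R`, where `T v j` is a set of vertices whose
colors can be read off from the code and from the colors of the other vertices. -/
theorem exists_good_listColoring {V ι : Type*} [DecidableEq V] (W : Finset V)
    (L : V → Finset ℕ) (R : ℕ) (hL : ∀ v ∈ W, R ≤ #(L v)) (Good : Finset V → (V → ℕ) → Prop)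
    (hlocal : ∀ S φ ψ, (∀ v ∈ S, φ v = ψ v) → Good S φ → Good S ψ)
    (hmono : ∀ S S' φ, S' ⊆ S → Good S φ → Good S' φ) (hempty : ∀ φ, Good ∅ φ)
    (β : ℝ) (hβ : 0 < β) (J : V → Finset ι) (T : V → ι → Finset V)
    (hsum : ∀ v ∈ W, β + ∑ j ∈ J v, (β ^ (#(T v j) - 1))⁻¹ ≤ R)
    (hT : ∀ v ∈ W, ∀ j ∈ J v, v ∈ T v j)
    (henc : ∀ S ⊆ W, ∀ v ∈ W, v ∉ S → ∃ e : (V → ℕ) → ι,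
      (∀ φ, Good S φ → ¬ Good (insert v S) φ → e φ ∈ J v ∧ T v (e φ) ⊆ insert v S) ∧
      ∀ φ ψ, Good S φ → ¬ Good (insert v S) φ → Good S ψ → ¬ Good (insert v S) ψ →
        e φ = e ψ → (∀ x ∈ S \ T v (e φ), φ x = ψ x) → ∀ x ∈ T v (e φ), φ x = ψ x) :
    ∃ φ : V → ℕ, (∀ v ∈ W, φ v ∈ L v) ∧ Good W φ := by
  have key : ∀ n, ∀ S ⊆ W, #S < n → ∀ v ∈ W, v ∉ S →
      β * #(goodColorings L Good S) ≤ #(goodColorings L Good (insert v S)) := by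
    intro n
    induction n with
    | zero => intro S _ h; omega
    | succ n ih =>
      intro S hS hn v hvW hv
      obtain ⟨e, he, hinj⟩ := henc S hS v hvW hv
      exact card_goodColorings_insert L R Good hlocal hmono β hβ S v hv (hL v hvW) (J v) (T v)
        (hsum v hvW) (hT v hvW) e he hinj
        (pow_mul_card_goodColorings_le hβ n W ih S hS (by omega))
  have h := pow_mul_card_goodColorings_le hβ (#W + 1) W (key _) W Subset.rfl (by omega) ∅
    (empty_subset W)
  have h0 : 0 < #(goodColorings L Good ∅) :=
    card_pos.2 ⟨0, mem_goodColorings.2 ⟨by simp, by simp, hempty 0⟩⟩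
  have hpos : (0 : ℝ) < #(goodColorings L Good W) :=
    lt_of_lt_of_le (by have : (0 : ℝ) < #(goodColorings L Good ∅) := by exact_mod_cast h0
                       positivity) h
  obtain ⟨φ, hφ⟩ := card_pos.1 (by exact_mod_cast hpos : 0 < #(goodColorings L Good W))
  exact ⟨φ, (mem_goodColorings.1 hφ).1, (mem_goodColorings.1 hφ).2.2⟩

/-! ### The growth factor and the number of pairs of intersecting edges -/

theorem ithRoot_nonneg (i : ℕ) {x : ℝ} (hx : 0 ≤ x) : 0 ≤ ithRoot i x := Real.rpow_nonneg hx _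

theorem ithRoot_pow {i : ℕ} (hi : i ≠ 0) {x : ℝ} (hx : 0 ≤ x) : ithRoot i x ^ i = x := by
  rw [ithRoot, one_div, Real.rpow_inv_natCast_pow hx hi]

/-- `q i * N ^ (1 / i)` is the minimum over `b > 0` of `b + N / b ^ (i - 1)`, attained at
`b = ((i - 1) * N) ^ (1 / i)`; beyond the minimizer the second term only decreases. -/
theorem div_pow_add_ithRoot_le {i : ℕ} (hi : 1 ≤ i) {N β : ℝ} (hN : 0 ≤ N) (hβ : 0 < β)
    (h : ithRoot i (((i : ℝ) - 1) * N) ≤ β) :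
    N * (β ^ (i - 1))⁻¹ + ithRoot i (((i : ℝ) - 1) * N) ≤ qConst i * ithRoot i N := by
  rcases hi.eq_or_lt with rfl | hi1
  · simp [qConst, ithRoot]
  have hi' : (0 : ℝ) < (i : ℝ) - 1 := by
    have : (1 : ℝ) < i := by exact_mod_cast hi1
    linarith
  have hq : qConst i * ithRoot i N = i / ((i : ℝ) - 1) * ithRoot i (((i : ℝ) - 1) * N) := by
    rw [qConst, if_neg (by omega), mul_assoc, ithRoot, ithRoot, ithRoot,
      Real.mul_rpow hi'.le hN]
  rw [hq]
  set b := ithRoot i (((i : ℝ) - 1) * N) with hb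
  have hb0 : 0 ≤ b := ithRoot_nonneg i (by positivity)
  have hbi : b * b ^ (i - 1) = ((i : ℝ) - 1) * N := by
    rw [← pow_succ', Nat.sub_add_cancel hi, hb, ithRoot_pow (by omega) (by positivity)]
  have hle : N * (β ^ (i - 1))⁻¹ ≤ b / ((i : ℝ) - 1) := by
    rw [← div_eq_mul_inv, div_le_div_iff₀ (by positivity) hi', mul_comm N, ← hbi]
    gcongr
  calc N * (β ^ (i - 1))⁻¹ + b ≤ b / ((i : ℝ) - 1) + b := by gcongr
    _ = i / ((i : ℝ) - 1) * b := by field_simp; ring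

/-- A growth factor for several conflict sizes at once: one plus the sum of the minimizers
for the single sizes. -/
theorem exists_growth_factor (I : Finset ℕ) (hI : ∀ i ∈ I, 1 ≤ i) (N : ℕ → ℝ)
    (hN : ∀ i ∈ I, 0 ≤ N i) :
    ∃ β : ℝ, 1 ≤ β ∧ β + ∑ i ∈ I, N i * (β ^ (i - 1))⁻¹ ≤
      1 + ∑ i ∈ I, qConst i * ithRoot i (N i) := by
  set b : ℕ → ℝ := fun i => ithRoot i (((i : ℝ) - 1) * N i) with hb
  have hb0 : ∀ i ∈ I, 0 ≤ b i := fun i hi => ithRoot_nonneg i <| mul_nonneg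
    (sub_nonneg.2 (by exact_mod_cast hI i hi)) (hN i hi)
  have hs : 0 ≤ ∑ i ∈ I, b i := sum_nonneg hb0
  refine ⟨1 + ∑ i ∈ I, b i, by linarith, ?_⟩
  rw [add_assoc, ← sum_add_distrib]
  gcongr with i hi
  rw [add_comm]
  refine div_pow_add_ithRoot_le (hI i hi) (hN i hi) (by linarith) ?_
  exact (single_le_sum hb0 hi).trans (by linarith)

/-- The ordered pairs of distinct intersecting edges. -/
def intersectingPairs {V : Type*} [DecidableEq V] (E : Finset (Finset V)) :
    Finset (Finset V × Finset V) :=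
  {p ∈ E ×ˢ E | p.1 ≠ p.2 ∧ (p.1 ∩ p.2).Nonempty}

theorem mem_intersectingPairs {V : Type*} [DecidableEq V] {E : Finset (Finset V)}
    {p : Finset V × Finset V} :
    p ∈ intersectingPairs E ↔ p.1 ∈ E ∧ p.2 ∈ E ∧ p.1 ≠ p.2 ∧ (p.1 ∩ p.2).Nonempty := by
  simp [intersectingPairs, and_assoc]

theorem card_edges_through_ne {V : Type*} [DecidableEq V] {E : Finset (Finset V)} {Δ : ℕ}
    (hdeg : ∀ v, #{P ∈ E | v ∈ P} ≤ Δ) {P : Finset V} (hP : P ∈ E) {u : V} (hu : u ∈ P) :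
    #{Q ∈ E | u ∈ Q ∧ Q ≠ P} ≤ Δ - 1 := by
  have : ({Q ∈ E | u ∈ Q ∧ Q ≠ P} : Finset _) = ({Q ∈ E | u ∈ Q} : Finset _).erase P := by
    ext Q; simp only [mem_filter, mem_erase]; tauto
  rw [this, card_erase_of_mem (by simp [hP, hu])]
  exact Nat.sub_le_sub_right (hdeg u) 1

/-- A bound on the number of pairs of edges, from a bound for each choice of the first edge among
the at most `Δ` edges through `v`. -/
theorem card_pairs_le {V : Type*} [DecidableEq V] {E : Finset (Finset V)} {Δ : ℕ}
    (hdeg : ∀ v, #{P ∈ E | v ∈ P} ≤ Δ) (v : V) (A : Finset (Finset V × Finset V))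
    (hA : ∀ p ∈ A, p.1 ∈ E ∧ v ∈ p.1 ∧ p.2 ∈ E) (c n : ℕ)
    (h : ∀ P ∈ E, v ∈ P → #{Q ∈ E | (P, Q) ∈ A} * c ≤ n) : #A * c ≤ Δ * n := by
  have hmaps : ∀ p ∈ A, p.1 ∈ ({P ∈ E | v ∈ P} : Finset _) := fun p hp =>
    mem_filter.2 ⟨(hA p hp).1, (hA p hp).2.1⟩
  rw [card_eq_sum_card_fiberwise hmaps, sum_mul]
  calc _ ≤ ∑ P ∈ E with v ∈ P, n := by
        refine sum_le_sum fun P hP => le_trans ?_ (h P (mem_filter.1 hP).1 (mem_filter.1 hP).2)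
        gcongr
        refine card_le_card_of_injOn Prod.snd ?_ ?_
        · rintro ⟨P', Q⟩ hp
          obtain ⟨h1, rfl⟩ := mem_filter.1 (mem_coe.1 hp)
          exact mem_coe.2 (mem_filter.2 ⟨(hA _ h1).2.2, h1⟩)
        · rintro ⟨P', Q⟩ hp ⟨P'', Q'⟩ hq hh
          obtain ⟨_, h1⟩ := mem_filter.1 (mem_coe.1 hp)
          obtain ⟨_, h2⟩ := mem_filter.1 (mem_coe.1 hq)
          exact Prod.ext (h1.trans h2.symm) hh
    _ ≤ Δ * n := by rw [sum_const, smul_eq_mul]; gcongr; exact hdeg v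

/-- Double counting of the incidences `u ∈ P ∩ Q`, `u ≠ v`, for a fixed edge `P` through `v`. -/
theorem card_pairs_mem_sdiff_mul_le {V : Type*} [DecidableEq V] {E : Finset (Finset V)}
    {k Δ : ℕ} (hunif : ∀ P ∈ E, #P = k) (hdeg : ∀ v, #{P ∈ E | v ∈ P} ≤ Δ) (v : V) (i : ℕ) :
    #{p ∈ intersectingPairs E | v ∈ p.1 \ p.2 ∧ #(p.1 \ p.2) = i} * (k - i) ≤
      Δ * ((Δ - 1) * (k - 1)) := by
  refine card_pairs_le hdeg v _ ?_ _ _ ?_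
  · intro p hp
    obtain ⟨h1, h2, _⟩ := mem_filter.1 hp
    have := mem_intersectingPairs.1 h1
    exact ⟨this.1, (mem_sdiff.1 h2).1, this.2.1⟩
  intro P hP hv
  set B := {Q ∈ E | (P, Q) ∈ ({p ∈ intersectingPairs E | v ∈ p.1 \ p.2 ∧ #(p.1 \ p.2) = i} :
    Finset _)} with hB
  have hBmem : ∀ Q ∈ B, Q ∈ E ∧ Q ≠ P ∧ v ∉ Q ∧ #(P \ Q) = i := by
    intro Q hQ
    simp only [hB, mem_filter, mem_intersectingPairs, mem_sdiff] at hQ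
    exact ⟨hQ.1, fun h => hQ.2.1.2.2.1 h.symm, hQ.2.2.1.2, hQ.2.2.2⟩
  calc #B * (k - i) ≤ ∑ Q ∈ B, #{u ∈ P.erase v | u ∈ Q} := by
        rw [← smul_eq_mul, ← sum_const]
        refine sum_le_sum fun Q hQ => ?_
        obtain ⟨h1, h2, h3, h4⟩ := hBmem Q hQ
        have : ({u ∈ P.erase v | u ∈ Q} : Finset _) = P ∩ Q := by
          ext u; simp only [mem_filter, mem_erase, mem_inter]
          exact ⟨fun h => ⟨h.1.2, h.2⟩, fun h => ⟨⟨ne_of_mem_of_not_mem h.2 h3, h.1⟩, h.2⟩⟩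
        rw [this]
        have := card_inter_add_card_sdiff P Q
        rw [hunif P hP] at this
        omega
    _ = ∑ u ∈ P.erase v, #{Q ∈ B | u ∈ Q} := by
        simp only [card_filter]; exact sum_comm
    _ ≤ ∑ u ∈ P.erase v, (Δ - 1) := by
        refine sum_le_sum fun u hu => le_trans (card_le_card ?_)
          (card_edges_through_ne hdeg hP (mem_erase.1 hu).2)
        intro Q hQ
        obtain ⟨h1, h2⟩ := mem_filter.1 hQ
        exact mem_filter.2 ⟨(hBmem Q h1).1, h2, (hBmem Q h1).2.1⟩
    _ = (Δ - 1) * (k - 1) := by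
        rw [sum_const, smul_eq_mul, card_erase_of_mem hv, hunif P hP, mul_comm]

theorem card_pairs_mem_inter_le {V : Type*} [DecidableEq V] {E : Finset (Finset V)}
    {Δ : ℕ} (hdeg : ∀ v, #{P ∈ E | v ∈ P} ≤ Δ) (v : V) :
    #{p ∈ intersectingPairs E | v ∈ p.1 ∩ p.2} ≤ Δ * (Δ - 1) := by
  have := card_pairs_le hdeg v {p ∈ intersectingPairs E | v ∈ p.1 ∩ p.2} ?_ 1 (Δ - 1) ?_
  · simpa using this
  · intro p hp
    obtain ⟨h1, h2⟩ := mem_filter.1 hp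
    have := mem_intersectingPairs.1 h1
    exact ⟨this.1, (mem_inter.1 h2).1, this.2.1⟩
  · intro P hP hv
    rw [mul_one]
    refine (card_le_card ?_).trans (card_edges_through_ne hdeg hP hv)
    intro Q hQ
    simp only [mem_filter, mem_intersectingPairs, mem_inter] at hQ ⊢
    exact ⟨hQ.1, hQ.2.2.2, fun h => hQ.2.1.2.2.1 h.symm⟩

theorem cast_mul_pred_mul {Δ k : ℕ} (hk : 1 ≤ k) :
    ((Δ * ((Δ - 1) * (k - 1)) : ℕ) : ℝ) = (Δ : ℝ) * ((Δ : ℝ) - 1) * ((k : ℝ) - 1) := by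
  rcases Δ.eq_zero_or_pos with rfl | h
  · simp
  · push_cast [Nat.cast_sub hk, Nat.cast_sub h]; ring

theorem card_pairs_mem_sdiff_le {V : Type*} [DecidableEq V] {E : Finset (Finset V)}
    {k Δ : ℕ} (hunif : ∀ P ∈ E, #P = k) (hdeg : ∀ v, #{P ∈ E | v ∈ P} ≤ Δ) (v : V) {i : ℕ}
    (hi : i < k) :
    (#{p ∈ intersectingPairs E | v ∈ p.1 \ p.2 ∧ #(p.1 \ p.2) = i} : ℝ) ≤
      (Δ : ℝ) * ((Δ : ℝ) - 1) * ((k : ℝ) - 1) / ((k : ℝ) - (i : ℝ)) := by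
  have hki : (0 : ℝ) < (k : ℝ) - i := sub_pos.2 (by exact_mod_cast hi)
  rw [le_div_iff₀ hki, ← cast_mul_pred_mul (by omega), ← Nat.cast_sub hi.le]
  exact_mod_cast card_pairs_mem_sdiff_mul_le hunif hdeg v i

theorem card_pairs_mem_inter_le_div {V : Type*} [DecidableEq V] {E : Finset (Finset V)}
    {k Δ : ℕ} (hdeg : ∀ v, #{P ∈ E | v ∈ P} ≤ Δ) (v : V) {i : ℕ} (hi1 : 1 ≤ i) (hi : i < k) :
    (#{p ∈ intersectingPairs E | v ∈ p.1 ∩ p.2} : ℝ) ≤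
      (Δ : ℝ) * ((Δ : ℝ) - 1) * ((k : ℝ) - 1) / ((k : ℝ) - (i : ℝ)) := by
  have hki : (0 : ℝ) < (k : ℝ) - i := sub_pos.2 (by exact_mod_cast hi)
  rw [le_div_iff₀ hki, ← cast_mul_pred_mul (by omega), ← Nat.cast_sub hi.le]
  have h := Nat.mul_le_mul (card_pairs_mem_inter_le hdeg v) (by omega : k - i ≤ k - 1)
  rw [mul_assoc] at h
  exact_mod_cast h

/-- The counting method for conflicts between two edges: the codes of a conflict at `v` consist of
a pair `(P, Q)` in `A v` and of further data in `κ (P, Q)`, and at least `#(P \ Q)` colors can be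
recovered from the code. `Enc S v φ j` says that `j` is a code of the extension `φ` of a coloring
of `S` to `v`. -/
theorem exists_good_listColoring_of_pairs {V : Type*} [DecidableEq V] (W : Finset V)
    (L : V → Finset ℕ) (R : ℕ) (hL : ∀ v ∈ W, R ≤ #(L v)) (Good : Finset V → (V → ℕ) → Prop)
    (hlocal : ∀ S φ ψ, (∀ v ∈ S, φ v = ψ v) → Good S φ → Good S ψ)
    (hmono : ∀ S S' φ, S' ⊆ S → Good S φ → Good S' φ) (hempty : ∀ φ, Good ∅ φ)
    (I : Finset ℕ) (hI : ∀ i ∈ I, 1 ≤ i) (N : ℕ → ℝ) (hN : ∀ i ∈ I, 0 ≤ N i)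
    (hR : 2 + ∑ i ∈ I, qConst i * ithRoot i (N i) ≤ R)
    (A : V → Finset (Finset V × Finset V)) (hA : ∀ v ∈ W, ∀ p ∈ A v, #(p.1 \ p.2) ∈ I)
    (κ : Finset V × Finset V → Type*) [∀ p, Fintype (κ p)]
    (hκ : ∀ v ∈ W, ∀ i ∈ I, (∑ p ∈ A v with #(p.1 \ p.2) = i, (Fintype.card (κ p) : ℝ)) ≤ N i)
    (T : V → (Σ p, κ p) → Finset V)
    (hT : ∀ v ∈ W, ∀ j, j.1 ∈ A v → v ∈ T v j ∧ #(j.1.1 \ j.1.2) ≤ #(T v j))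
    (Enc : Finset V → V → (V → ℕ) → (Σ p, κ p) → Prop)
    (hex : ∀ S ⊆ W, ∀ v ∈ W, v ∉ S → ∀ φ, Good S φ → ¬ Good (insert v S) φ →
      ∃ j, j.1 ∈ A v ∧ T v j ⊆ insert v S ∧ Enc S v φ j)
    (hinj : ∀ S ⊆ W, ∀ v ∈ W, v ∉ S → ∀ j, j.1 ∈ A v → T v j ⊆ insert v S → ∀ φ ψ,
      Enc S v φ j → Enc S v ψ j → (∀ x ∈ S \ T v j, φ x = ψ x) → ∀ x ∈ T v j, φ x = ψ x) :
    ∃ φ : V → ℕ, (∀ v ∈ W, φ v ∈ L v) ∧ Good W φ := by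
  obtain ⟨β, hβ, hsum⟩ := exists_growth_factor I hI N hN
  rcases isEmpty_or_nonempty (Σ p, κ p) with hemp | hne
  · -- without codes there are no conflicts, and any choice of colors will do
    refine exists_good_listColoring (ι := Unit) W L R hL Good hlocal hmono hempty 1 one_pos
      (fun _ => ∅) (fun _ _ => ∅) (fun v hv => ?_) (by simp) (fun S hS v hv hvS => ?_)
    · have : (0 : ℝ) ≤ ∑ i ∈ I, N i * (β ^ (i - 1))⁻¹ :=
        sum_nonneg fun i hi => mul_nonneg (hN i hi) (by positivity)
      simp only [sum_empty, add_zero]; linarith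
    · exact ⟨fun _ => (), fun φ h1 h2 => (hemp.false (hex S hS v hv hvS φ h1 h2).choose).elim,
        fun φ _ h1 h2 => (hemp.false (hex S hS v hv hvS φ h1 h2).choose).elim⟩
  refine exists_good_listColoring W L R hL Good hlocal hmono hempty β (by linarith)
    (fun v => (A v).sigma fun _ => univ) T (fun v hv => ?_) (fun v hv j hj => ?_)
    (fun S hS v hv hvS => ?_)
  · have : ∑ j ∈ (A v).sigma fun p => (univ : Finset (κ p)), (β ^ (#(T v j) - 1))⁻¹ ≤
        ∑ i ∈ I, N i * (β ^ (i - 1))⁻¹ := by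
      calc _ ≤ ∑ j ∈ (A v).sigma fun p => (univ : Finset (κ p)),
              (β ^ (#(j.1.1 \ j.1.2) - 1))⁻¹ := by
            refine sum_le_sum fun j hj => ?_
            have h := (hT v hv j (mem_sigma.1 hj).1).2
            gcongr
        _ = ∑ p ∈ A v, (Fintype.card (κ p) : ℝ) * (β ^ (#(p.1 \ p.2) - 1))⁻¹ := by
            rw [sum_sigma]; simp
        _ = ∑ i ∈ I, ∑ p ∈ A v with #(p.1 \ p.2) = i,
              (Fintype.card (κ p) : ℝ) * (β ^ (#(p.1 \ p.2) - 1))⁻¹ :=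
            (sum_fiberwise_of_maps_to (hA v hv) _).symm
        _ ≤ ∑ i ∈ I, N i * (β ^ (i - 1))⁻¹ := by
            refine sum_le_sum fun i hi => ?_
            rw [sum_congr rfl (g := fun p => (Fintype.card (κ p) : ℝ) * (β ^ (i - 1))⁻¹)
              (fun p hp => by rw [(mem_filter.1 hp).2]), ← sum_mul]
            gcongr
            exact hκ v hv i hi
    linarith
  · exact (hT v hv j (mem_sigma.1 hj).1).1
  · have : ∀ φ, ∃ j, Good S φ → ¬ Good (insert v S) φ →
        j.1 ∈ A v ∧ T v j ⊆ insert v S ∧ Enc S v φ j := by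
      intro φ
      by_cases h : Good S φ ∧ ¬ Good (insert v S) φ
      · obtain ⟨j, hj⟩ := hex S hS v hv hvS φ h.1 h.2
        exact ⟨j, fun _ _ => hj⟩
      · exact ⟨Classical.arbitrary _, fun h1 h2 => (h ⟨h1, h2⟩).elim⟩
    choose e he using this
    refine ⟨e, fun φ h1 h2 => ?_, fun φ ψ h1 h2 h3 h4 h5 => ?_⟩
    · obtain ⟨a, b, _⟩ := he φ h1 h2
      exact ⟨mem_sigma.2 ⟨a, mem_univ _⟩, b⟩
    · obtain ⟨a, b, c⟩ := he φ h1 h2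
      exact hinj S hS v hv hvS _ a b φ ψ c (h5 ▸ (he ψ h3 h4).2.2)

/-! ### Distinguishing edges by multisets of colors -/

/-- Equal multisets of colors are matched by a color-preserving bijection. -/
theorem exists_equiv_of_map_val_eq {V : Type*} {s t : Finset V} {φ : V → ℕ}
    (h : s.val.map φ = t.val.map φ) : ∃ σ : s ≃ t, ∀ x : s, φ (σ x) = φ x := by
  classical
  have hc : ∀ c, Nonempty ({x : s // φ x = c} ≃ {y : t // φ y = c}) := by
    intro c
    have key : ∀ u : Finset V, Fintype.card {x : u // φ x = c} = (u.val.map φ).count c := by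
      intro u
      rw [Fintype.card_subtype, Multiset.count_map, ← card_map (Function.Embedding.subtype _)]
      change _ = #({a ∈ u | c = φ a})
      congr 1
      ext x
      simp [eq_comm, and_comm]
    exact ⟨Fintype.equivOfCardEq (by rw [key, key, h])⟩
  exact ⟨Equiv.ofFiberEquiv (f := fun x : s => φ x) (g := fun y : t => φ y) fun c => (hc c).some,
    fun x => Equiv.ofFiberEquiv_map (f := fun x : s => φ x) (g := fun y : t => φ y)
      (fun c => (hc c).some) x⟩

/-- No conflict by multisets among the pairs of edges whose symmetric difference lies in `S`.
Colors on the intersection of two edges do not matter, so they may be missing. -/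
def MultisetGood {V : Type*} [DecidableEq V] (E : Finset (Finset V)) (S : Finset V)
    (φ : V → ℕ) : Prop :=
  ∀ P ∈ E, ∀ Q ∈ E, P ≠ Q → (P ∩ Q).Nonempty → P \ Q ⊆ S → Q \ P ⊆ S →
    (P \ Q).val.map φ ≠ (Q \ P).val.map φ

theorem map_sdiff_val_eq {V : Type*} [DecidableEq V] {P Q : Finset V} {φ : V → ℕ}
    (h : P.val.map φ = Q.val.map φ) : (P \ Q).val.map φ = (Q \ P).val.map φ := by
  have key : ∀ A B : Finset V, A.val.map φ = (A \ B).val.map φ + (A ∩ B).val.map φ := by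
    intro A B
    rw [← Multiset.map_add]
    congr 1
    have := disjUnion_val (A \ B) (A ∩ B) (disjoint_sdiff_inter A B)
    rw [← this, disjUnion_eq_union, sdiff_union_inter]
  rw [key P Q, key Q P, inter_comm Q P] at h
  exact add_right_cancel h

/-- List colorings distinguishing intersecting edges by multisets: a conflict of `P`, `Q` at
`v ∈ P \ Q` is encoded by a color-preserving bijection between `P \ Q` and `Q \ P`. -/
theorem exists_multisetGood {V : Type*} [DecidableEq V] (W : Finset V) (E : Finset (Finset V))
    (k Δ R : ℕ) (hunif : ∀ P ∈ E, #P = k) (hdeg : ∀ v, #{P ∈ E | v ∈ P} ≤ Δ)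
    (L : V → Finset ℕ) (hL : ∀ v ∈ W, R ≤ #(L v))
    (I : Finset ℕ) (hI : ∀ i ∈ I, 1 ≤ i ∧ i < k)
    (hEI : ∀ p ∈ intersectingPairs E, #(p.1 \ p.2) ∈ I)
    (hR : 2 + ∑ i ∈ I, qConst i * ithRoot i
      ((Δ : ℝ) * ((Δ : ℝ) - 1) * ((k : ℝ) - 1) / ((k : ℝ) - (i : ℝ)) * (Nat.factorial i : ℝ)) ≤ R) :
    ∃ φ : V → ℕ, (∀ v ∈ W, φ v ∈ L v) ∧ MultisetGood E W φ := by
  have hcount : ∀ v : V, ∀ i ∈ I, _ := fun v i hi =>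
    card_pairs_mem_sdiff_le hunif hdeg v (hI i hi).2
  have hN : ∀ v : V, ∀ i ∈ I,
      0 ≤ (Δ : ℝ) * ((Δ : ℝ) - 1) * ((k : ℝ) - 1) / ((k : ℝ) - (i : ℝ)) * (Nat.factorial i : ℝ) :=
    fun v i hi => mul_nonneg ((Nat.cast_nonneg _).trans (hcount v i hi)) (Nat.cast_nonneg _)
  rcases isEmpty_or_nonempty V with hV | ⟨⟨v₀⟩⟩
  · refine ⟨fun _ => 0, fun v => (hV.false v).elim, fun P _ Q _ hPQ => (hPQ ?_).elim⟩
    exact Subsingleton.elim _ _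
  refine exists_good_listColoring_of_pairs W L R hL (MultisetGood E) ?_ ?_ ?_ I
    (fun i hi => (hI i hi).1) _ (hN v₀) hR
    (fun v => {p ∈ intersectingPairs E | v ∈ p.1 \ p.2})
    (fun v _ p hp => hEI p (mem_filter.1 hp).1)
    (fun p => (p.1 \ p.2 : Finset V) ≃ (p.2 \ p.1 : Finset V)) ?_
    (fun _ j => j.1.1 \ j.1.2)
    (fun v _ j hj => ⟨(mem_filter.1 hj).2, le_rfl⟩)
    (fun S v φ j => j.1.2 \ j.1.1 ⊆ S ∧ ∀ x, φ (j.2 x) = φ x) ?_ ?_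
  · intro S φ ψ h hφ P hP Q hQ hne hint h1 h2 h3
    refine hφ P hP Q hQ hne hint h1 h2 ?_
    rw [Multiset.map_congr rfl (fun x hx => h x (h1 hx)), h3]
    exact Multiset.map_congr rfl (fun x hx => (h x (h2 hx)).symm)
  · intro S S' φ hS hφ P hP Q hQ hne hint h1 h2
    exact hφ P hP Q hQ hne hint (h1.trans hS) (h2.trans hS)
  · intro φ P hP Q hQ hne _ h1 h2 _
    exact hne ((sdiff_eq_empty_iff_subset.1 (subset_empty.1 h1)).antisymm
      (sdiff_eq_empty_iff_subset.1 (subset_empty.1 h2)))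
  · intro v _ i hi
    have hcard : ∀ p ∈ ({p ∈ intersectingPairs E | v ∈ p.1 \ p.2} : Finset _).filter
        (fun p => #(p.1 \ p.2) = i),
        (Fintype.card ((p.1 \ p.2 : Finset V) ≃ (p.2 \ p.1 : Finset V)) : ℝ) =
          (Nat.factorial i : ℝ) := by
      intro p hp
      obtain ⟨h1, h2⟩ := mem_filter.1 hp
      have h3 := mem_intersectingPairs.1 (mem_filter.1 h1).1
      have h4 : #(p.1 \ p.2) = #(p.2 \ p.1) :=
        card_sdiff_comm ((hunif _ h3.1).trans (hunif _ h3.2.1).symm)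
      rw [Fintype.card_equiv (Fintype.equivOfCardEq (by simpa using h4)), Fintype.card_coe, h2]
    rw [sum_congr rfl hcard, sum_const, nsmul_eq_mul, filter_filter]
    gcongr
    exact hcount v i hi
  · intro S _ v _ hvS φ hg hb
    simp only [MultisetGood, not_forall, not_not] at hb
    obtain ⟨P, hP, Q, hQ, hne, hint, h1, h2, h3⟩ := hb
    have main : ∀ P ∈ E, ∀ Q ∈ E, P ≠ Q → (P ∩ Q).Nonempty → P \ Q ⊆ insert v S →
        Q \ P ⊆ insert v S → (P \ Q).val.map φ = (Q \ P).val.map φ → v ∈ P \ Q →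
        ∃ j : Σ p : Finset V × Finset V, (p.1 \ p.2 : Finset V) ≃ (p.2 \ p.1 : Finset V),
          j.1 ∈ ({p ∈ intersectingPairs E | v ∈ p.1 \ p.2} : Finset _) ∧
          j.1.1 \ j.1.2 ⊆ insert v S ∧ j.1.2 \ j.1.1 ⊆ S ∧ ∀ x, φ (j.2 x) = φ x := by
      intro P hP Q hQ hne hint h1 h2 h3 hv
      obtain ⟨σ, hσ⟩ := exists_equiv_of_map_val_eq h3
      refine ⟨⟨(P, Q), σ⟩, mem_filter.2 ⟨mem_intersectingPairs.2 ⟨hP, hQ, hne, hint⟩, hv⟩, h1,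
        ?_, hσ⟩
      refine (subset_insert_iff_of_notMem ?_).1 h2
      exact fun h => (mem_sdiff.1 h).2 (mem_sdiff.1 hv).1
    by_cases hv1 : v ∈ P \ Q
    · exact main P hP Q hQ hne hint h1 h2 h3 hv1
    by_cases hv2 : v ∈ Q \ P
    · exact main Q hQ P hP hne.symm (inter_comm P Q ▸ hint) h2 h1 h3.symm hv2
    · exact (hg P hP Q hQ hne hint ((subset_insert_iff_of_notMem hv1).1 h1)
        ((subset_insert_iff_of_notMem hv2).1 h2) h3).elim
  · rintro S _ v _ hvS ⟨⟨P, Q⟩, σ⟩ _ _ φ ψ ⟨hS, h1⟩ ⟨_, h2⟩ h x hx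
    have hy := (σ ⟨x, hx⟩).2
    have := h (σ ⟨x, hx⟩) (mem_sdiff.2 ⟨hS hy,
      fun h' => (mem_sdiff.1 hy).2 (mem_sdiff.1 h').1⟩)
    rw [h1, h2] at this
    exact this

/-! ### Distinguishing edges by sets of colors -/

/-- The total preorders of a type. -/
abbrev TotalPreorderRel (α : Type*) := {r : α → α → Prop // IsPreorder α r ∧ Std.Total r}

/-- The pullback of a total preorder. -/
def TotalPreorderRel.comap {α β : Type*} (f : α → β) (r : TotalPreorderRel β) :
    TotalPreorderRel α :=
  ⟨fun x y => r.1 (f x) (f y),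
    { refl := fun _ => r.2.1.refl _, trans := fun _ _ _ => r.2.1.trans _ _ _ },
    ⟨fun _ _ => r.2.2.total _ _⟩⟩

theorem card_totalPreorderRel {α : Type*} [Fintype α] {n : ℕ} (hn : Fintype.card α = n) :
    Nat.card (TotalPreorderRel α) = fubiniNumber n :=
  have e := Fintype.equivFinOfCardEq hn
  Nat.card_congr
    { toFun := TotalPreorderRel.comap e.symm
      invFun := TotalPreorderRel.comap e
      left_inv := fun r => by ext; simp [TotalPreorderRel.comap]
      right_inv := fun r => by ext; simp [TotalPreorderRel.comap] }

/-- The total preorder in which points are compared by their values under `f`. -/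
def TotalPreorderRel.ofFun {α : Type*} (f : α → ℕ) : TotalPreorderRel α :=
  ⟨fun x y => f x ≤ f y, { refl := fun _ => le_rfl, trans := fun _ _ _ => le_trans },
    ⟨fun _ _ => le_total _ _⟩⟩

/-- A function is determined by its range and by the preorder it induces. -/
theorem eq_of_range_eq_of_ofFun_eq {α : Type*} {f g : α → ℕ} (hr : Set.range f = Set.range g)
    (ho : TotalPreorderRel.ofFun f = TotalPreorderRel.ofFun g) : f = g := by
  have ho' : ∀ x y, f x ≤ f y ↔ g x ≤ g y := fun x y =>
    iff_of_eq (congrFun (congrFun (congrArg Subtype.val ho) x) y)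
  suffices h : ∀ c x, f x = c → g x = c from funext fun x => (h (f x) x rfl).symm
  intro c
  induction c using Nat.strong_induction_on with
  | _ c ih =>
    rintro x rfl
    obtain ⟨z, hz⟩ : f x ∈ Set.range g := hr ▸ Set.mem_range_self x
    have hxz : f x ≤ f z := by
      by_contra! h
      have := ih _ h z rfl
      omega
    have hle : g x ≤ f x := by rw [← hz]; exact (ho' _ _).1 hxz
    refine hle.antisymm ?_
    by_contra! h
    obtain ⟨w, hw⟩ : g x ∈ Set.range f := hr.symm ▸ Set.mem_range_self x
    have h1 := ih (f w) (by omega) w rfl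
    have h2 := (ho' x w).2 (by omega)
    omega

/-- If `X` and `Y` have the same colors apart from those of `Z`, then the colors of `X` can be
read off from the colors of `Y` and `Z` and the set of those `x ∈ Z` whose color occurs on `X`. -/
theorem mem_image_iff_of_union {V : Type*} {X Y Z : Finset V} {φ : V → ℕ} {d : ℕ}
    (h : (d ∈ X.image φ ∨ d ∈ Z.image φ) ↔ (d ∈ Y.image φ ∨ d ∈ Z.image φ)) :
    d ∈ X.image φ ↔ (d ∈ Y.image φ ∧ d ∉ Z.image φ) ∨ d ∈ {x ∈ Z | φ x ∈ X.image φ}.image φ := by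
  have : d ∈ {x ∈ Z | φ x ∈ X.image φ}.image φ ↔ d ∈ Z.image φ ∧ d ∈ X.image φ := by
    constructor
    · intro hd
      obtain ⟨x, hx, rfl⟩ := mem_image.1 hd
      exact ⟨mem_image_of_mem _ (mem_filter.1 hx).1, (mem_filter.1 hx).2⟩
    · rintro ⟨hd, hd'⟩
      obtain ⟨x, hx, rfl⟩ := mem_image.1 hd
      exact mem_image_of_mem _ (mem_filter.2 ⟨hx, hd'⟩)
  rw [this]; tauto

/-- Two colorings that agree on `Y` and `Z`, and have the same set of `x ∈ Z` whose color occurs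
on `X`, have the same colors on `X`. -/
theorem mem_image_congr_of_union {V : Type*} {X Y Z : Finset V} {φ ψ : V → ℕ} {d : ℕ}
    (hφ : (d ∈ X.image φ ∨ d ∈ Z.image φ) ↔ (d ∈ Y.image φ ∨ d ∈ Z.image φ))
    (hψ : (d ∈ X.image ψ ∨ d ∈ Z.image ψ) ↔ (d ∈ Y.image ψ ∨ d ∈ Z.image ψ))
    (hD : {x ∈ Z | φ x ∈ X.image φ} = {x ∈ Z | ψ x ∈ X.image ψ})
    (hY : ∀ x ∈ Y, φ x = ψ x) (hZ : ∀ x ∈ Z, φ x = ψ x) :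
    d ∈ X.image φ ↔ d ∈ X.image ψ := by
  rw [mem_image_iff_of_union hφ, mem_image_iff_of_union hψ, ← hD, image_congr (s := Y) hY,
    image_congr (s := Z) hZ,
    image_congr (s := {x ∈ Z | φ x ∈ X.image φ}) (fun x hx => hZ x (mem_filter.1 hx).1)]

/-- No conflict by sets among the pairs of edges whose symmetric difference lies in `S`. The
intersection of the two edges may be colored partially; once the pair is in conflict, it stays so
when further vertices of the intersection receive colors. -/
def SetGood {V : Type*} [DecidableEq V] (E : Finset (Finset V)) (S : Finset V)
    (φ : V → ℕ) : Prop :=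
  ∀ P ∈ E, ∀ Q ∈ E, P ≠ Q → (P ∩ Q).Nonempty → P \ Q ⊆ S → Q \ P ⊆ S →
    (P ∩ S).image φ ≠ (Q ∩ S).image φ

theorem SetGood.mono {V : Type*} [DecidableEq V] {E : Finset (Finset V)} {S S' : Finset V}
    {φ : V → ℕ} (hS : S' ⊆ S) (h : SetGood E S φ) : SetGood E S' φ := by
  intro P hP Q hQ hne hint h1 h2 heq
  refine h P hP Q hQ hne hint (h1.trans hS) (h2.trans hS) ?_
  have key : ∀ A B : Finset V, A \ B ⊆ S' → (A ∩ S').image φ = (B ∩ S').image φ →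
      (A ∩ S).image φ ⊆ (B ∩ S).image φ := by
    intro A B hAB h d hd
    obtain ⟨x, hx, rfl⟩ := mem_image.1 hd
    obtain ⟨hxA, hxS⟩ := mem_inter.1 hx
    by_cases hxB : x ∈ B
    · exact mem_image_of_mem _ (mem_inter.2 ⟨hxB, hxS⟩)
    · have : φ x ∈ (B ∩ S').image φ :=
        h ▸ mem_image_of_mem _ (mem_inter.2 ⟨hxA, hAB (mem_sdiff.2 ⟨hxA, hxB⟩)⟩)
      exact image_subset_image (inter_subset_inter_left hS) this
  exact (key P Q h1 heq).antisymm (key Q P h2 heq.symm)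

/-- The codes of a conflict between `P` and `Q`: a set of vertices of `P ∩ Q` (those whose color
occurs on `P \ Q`) and a total preorder of `P \ Q`. -/
abbrev SetCode {V : Type*} [DecidableEq V] (p : Finset V × Finset V) :=
  (p.1 ∩ p.2).powerset × TotalPreorderRel (p.1 \ p.2 : Finset V)

noncomputable instance {V : Type*} [DecidableEq V] (p : Finset V × Finset V) :
    Fintype (SetCode p) := Fintype.ofFinite _

theorem card_setCode {V : Type*} [DecidableEq V] (p : Finset V × Finset V) :
    Fintype.card (SetCode p) = 2 ^ #(p.1 ∩ p.2) * fubiniNumber #(p.1 \ p.2) := by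
  rw [← Nat.card_eq_fintype_card, Nat.card_prod, card_totalPreorderRel (Fintype.card_coe _),
    Nat.card_eq_fintype_card, Fintype.card_coe, card_powerset]

open Classical in
/-- A minimal vertex of a total preorder of `X`, or `v` if there is none. -/
noncomputable def minVertex {V : Type*} {X : Finset V} (r : TotalPreorderRel X) (v : V) : V :=
  if h : ∃ x : X, ∀ y, r.1 x y then (h.choose : V) else v

/-- The vertices whose colors are recovered from a code of a conflict at `v`: all of `P \ Q` if
`v` belongs to it; if `v` lies in `P ∩ Q`, a minimal vertex of `P \ Q` is exchanged for `v`. -/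
noncomputable def recoveredSet {V : Type*} [DecidableEq V] (v : V)
    (j : Σ p : Finset V × Finset V, SetCode p) : Finset V :=
  if v ∈ j.1.2 then insert v ((j.1.1 \ j.1.2).erase (minVertex j.2.2 v)) else j.1.1 \ j.1.2

/-- `φ` with the color `c` moved below all other colors. -/
def lowerColor {V : Type*} (c : ℕ) (φ : V → ℕ) (x : V) : ℕ := if φ x = c then 0 else φ x + 1

/-- `j` is a code of the coloring `φ` of `insert v S`, in which the pair `j.1 = (P, Q)` is in
conflict. If `v` lies in `P ∩ Q`, then its color occurs on `P \ Q`, and the preorder in the code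
has the vertices of this color at the bottom. -/
def IsSetCode {V : Type*} [DecidableEq V] (S : Finset V) (v : V) (φ : V → ℕ)
    (j : Σ p : Finset V × Finset V, SetCode p) : Prop :=
  j.1.2 \ j.1.1 ⊆ insert v S ∧
  (j.2.1 : Finset V) = {x ∈ j.1.1 ∩ j.1.2 ∩ S | φ x ∈ (j.1.1 \ j.1.2).image φ} ∧
  (j.1.1 ∩ insert v S).image φ = (j.1.2 ∩ insert v S).image φ ∧
  if v ∈ j.1.2 then φ v ∈ (j.1.1 \ j.1.2).image φ ∧
      j.2.2 = TotalPreorderRel.ofFun (fun x : (j.1.1 \ j.1.2 : Finset V) => lowerColor (φ v) φ x)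
    else j.2.2 = TotalPreorderRel.ofFun (fun x : (j.1.1 \ j.1.2 : Finset V) => φ x)

theorem exists_isSetCode {V : Type*} [DecidableEq V] {E : Finset (Finset V)} {S : Finset V}
    {v : V} {φ : V → ℕ} (hg : SetGood E S φ) (hb : ¬ SetGood E (insert v S) φ) :
    ∃ j : Σ p : Finset V × Finset V, SetCode p,
      j.1 ∈ ({p ∈ intersectingPairs E | v ∈ p.1} : Finset _) ∧
        j.1.1 \ j.1.2 ⊆ insert v S ∧ IsSetCode S v φ j := by
  simp only [SetGood, not_forall, not_not] at hb
  obtain ⟨P, hP, Q, hQ, hne, hint, h1, h2, h3⟩ := hb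
  have main : ∀ P ∈ E, ∀ Q ∈ E, P ≠ Q → (P ∩ Q).Nonempty → P \ Q ⊆ insert v S →
      Q \ P ⊆ insert v S → (P ∩ insert v S).image φ = (Q ∩ insert v S).image φ → v ∈ P →
      (v ∈ Q → φ v ∈ (P \ Q).image φ) → ∃ j : Σ p : Finset V × Finset V, SetCode p,
      j.1 ∈ ({p ∈ intersectingPairs E | v ∈ p.1} : Finset _) ∧
        j.1.1 \ j.1.2 ⊆ insert v S ∧ IsSetCode S v φ j := by
    intro P hP Q hQ hne hint h1 h2 h3 hv hvQ
    refine ⟨⟨(P, Q), ⟨{x ∈ P ∩ Q ∩ S | φ x ∈ (P \ Q).image φ}, mem_powerset.2 ?_⟩,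
      if v ∈ Q then TotalPreorderRel.ofFun (fun x => lowerColor (φ v) φ x)
        else TotalPreorderRel.ofFun (fun x => φ x)⟩,
      mem_filter.2 ⟨mem_intersectingPairs.2 ⟨hP, hQ, hne, hint⟩, hv⟩, h1, h2, rfl, h3, ?_⟩
    · exact (filter_subset _ _).trans inter_subset_left
    · by_cases h : v ∈ Q
      · simp only [h, if_true]; exact ⟨hvQ h, trivial⟩
      · simp only [h, if_false]
  by_cases hvP : v ∈ P <;> by_cases hvQ : v ∈ Q
  · have hS1 : P \ Q ⊆ S := (subset_insert_iff_of_notMem (by simp [hvQ])).1 h1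
    have hS2 : Q \ P ⊆ S := (subset_insert_iff_of_notMem (by simp [hvP])).1 h2
    have hneS := hg P hP Q hQ hne hint hS1 hS2
    have h3' := h3
    rw [inter_insert_of_mem hvP, inter_insert_of_mem hvQ, image_insert, image_insert] at h3'
    -- the color of `v` is the only one by which the colors of `P` and `Q` differed before
    have hor : (φ v ∈ (P ∩ S).image φ ∧ φ v ∉ (Q ∩ S).image φ) ∨
        (φ v ∈ (Q ∩ S).image φ ∧ φ v ∉ (P ∩ S).image φ) := by
      by_contra hcon
      refine hneS (Finset.ext fun d => ?_)
      by_cases hd : d = φ v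
      · subst hd; tauto
      · have := Finset.ext_iff.1 h3' d
        simpa only [mem_insert, hd, false_or] using this
    have hmem : ∀ A B : Finset V, φ v ∈ (A ∩ S).image φ → φ v ∉ (B ∩ S).image φ →
        φ v ∈ (A \ B).image φ := by
      intro A B hA hB
      obtain ⟨x, hx, hxv⟩ := mem_image.1 hA
      obtain ⟨hxA, hxS⟩ := mem_inter.1 hx
      refine mem_image.2 ⟨x, mem_sdiff.2 ⟨hxA, fun hxB => hB ?_⟩, hxv⟩
      exact hxv ▸ mem_image_of_mem _ (mem_inter.2 ⟨hxB, hxS⟩)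
    rcases hor with h | h
    · exact main P hP Q hQ hne hint h1 h2 h3 hvP fun _ => hmem P Q h.1 h.2
    · exact main Q hQ P hP hne.symm (inter_comm P Q ▸ hint) h2 h1 h3.symm hvQ
        fun _ => hmem Q P h.1 h.2
  · exact main P hP Q hQ hne hint h1 h2 h3 hvP fun h => (hvQ h).elim
  · exact main Q hQ P hP hne.symm (inter_comm P Q ▸ hint) h2 h1 h3.symm hvQ
      fun h => (hvP h).elim
  · refine (hg P hP Q hQ hne hint ((subset_insert_iff_of_notMem (by simp [hvP])).1 h1)
      ((subset_insert_iff_of_notMem (by simp [hvQ])).1 h2) ?_).elim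
    rwa [inter_insert_of_notMem hvP, inter_insert_of_notMem hvQ] at h3

/-- Splitting off the common part of two edges with equal color sets. -/
theorem mem_image_sdiff_or_iff {V : Type*} [DecidableEq V] {P Q S : Finset V} {v : V}
    {φ : V → ℕ} (h1 : P \ Q ⊆ insert v S) (h2 : Q \ P ⊆ insert v S)
    (h : (P ∩ insert v S).image φ = (Q ∩ insert v S).image φ) {d : ℕ}
    (hd : v ∈ P ∩ Q → d ≠ φ v) :
    (d ∈ (P \ Q).image φ ∨ d ∈ (P ∩ Q ∩ S).image φ) ↔
      (d ∈ (Q \ P).image φ ∨ d ∈ (P ∩ Q ∩ S).image φ) := by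
  have key : ∀ A B : Finset V, A \ B ⊆ insert v S → (v ∈ A ∩ B → d ≠ φ v) →
      (d ∈ (A ∩ insert v S).image φ ↔
        (d ∈ (A \ B).image φ ∨ d ∈ (A ∩ B ∩ S).image φ)) := by
    intro A B hAB hd
    simp only [mem_image]
    constructor
    · rintro ⟨x, hx, rfl⟩
      obtain ⟨hxA, hxS⟩ := mem_inter.1 hx
      by_cases hxB : x ∈ B
      · refine .inr ⟨x, mem_inter.2 ⟨mem_inter.2 ⟨hxA, hxB⟩, ?_⟩, rfl⟩
        rcases mem_insert.1 hxS with rfl | h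
        · exact (hd (mem_inter.2 ⟨hxA, hxB⟩) rfl).elim
        · exact h
      · exact .inl ⟨x, mem_sdiff.2 ⟨hxA, hxB⟩, rfl⟩
    · rintro (⟨x, hx, rfl⟩ | ⟨x, hx, rfl⟩)
      · exact ⟨x, mem_inter.2 ⟨(mem_sdiff.1 hx).1, hAB hx⟩, rfl⟩
      · obtain ⟨h1, h2⟩ := mem_inter.1 hx
        exact ⟨x, mem_inter.2 ⟨(mem_inter.1 h1).1, mem_insert_of_mem h2⟩, rfl⟩
  rw [← key P Q h1 hd, h, key Q P h2 (inter_comm P Q ▸ hd), inter_comm Q P]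

theorem range_coe_eq_of_mem_image_iff {V : Type*} {X : Finset V} {f g : V → ℕ}
    (h : ∀ d, d ∈ X.image f ↔ d ∈ X.image g) :
    Set.range (fun x : X => f x) = Set.range (fun x : X => g x) := by
  ext d
  simpa [mem_image] using h d

theorem succ_mem_image_lowerColor {V : Type*} {X : Finset V} {φ : V → ℕ} {c d : ℕ} :
    d + 1 ∈ X.image (lowerColor c φ) ↔ d ≠ c ∧ d ∈ X.image φ := by
  simp only [mem_image, lowerColor]
  constructor
  · rintro ⟨x, hx, h⟩
    split_ifs at h with hc
    have : φ x = d := by omega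
    exact ⟨this ▸ hc, x, hx, this⟩
  · rintro ⟨hd, x, hx, rfl⟩
    exact ⟨x, hx, by simp [hd]⟩

theorem zero_mem_image_lowerColor {V : Type*} {X : Finset V} {φ : V → ℕ} {c : ℕ}
    (h : c ∈ X.image φ) : 0 ∈ X.image (lowerColor c φ) := by
  obtain ⟨x, hx, rfl⟩ := mem_image.1 h
  exact mem_image.2 ⟨x, hx, by simp [lowerColor]⟩

theorem lowerColor_injective {V : Type*} {φ ψ : V → ℕ} {c : ℕ} {x : V}
    (h : lowerColor c φ x = lowerColor c ψ x) : φ x = ψ x := by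
  unfold lowerColor at h
  split_ifs at h <;> omega

/-- If the color `c` occurs on `X`, then the minimal vertex of the preorder with `c` at the bottom
has the color `c`. -/
theorem minVertex_lowerColor {V : Type*} {X : Finset V} {φ : V → ℕ} {c : ℕ}
    (h : c ∈ X.image φ) (v : V) :
    minVertex (TotalPreorderRel.ofFun (fun x : X => lowerColor c φ x)) v ∈ X ∧
      φ (minVertex (TotalPreorderRel.ofFun (fun x : X => lowerColor c φ x)) v) = c := by
  obtain ⟨x, hx, hxc⟩ := mem_image.1 h
  have hx0 : lowerColor c φ x = 0 := by simp [lowerColor, hxc]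
  have hex : ∃ x : X, ∀ y, (TotalPreorderRel.ofFun (fun x : X => lowerColor c φ x)).1 x y :=
    ⟨⟨x, hx⟩, fun y => by simp [TotalPreorderRel.ofFun, hx0]⟩
  rw [minVertex, dif_pos hex]
  refine ⟨hex.choose.2, ?_⟩
  have := hex.choose_spec ⟨x, hx⟩
  simp only [TotalPreorderRel.ofFun, lowerColor] at this
  split_ifs at this with h
  · exact h
  · omega

/-- A coloring is recovered from its code and the colors outside `recoveredSet`. -/
theorem IsSetCode.eq_on_recoveredSet {V : Type*} [DecidableEq V] {S : Finset V} {v : V}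
    (hvS : v ∉ S) {φ ψ : V → ℕ} {j : Σ p : Finset V × Finset V, SetCode p} (hvP : v ∈ j.1.1)
    (hPQ : j.1.1 \ j.1.2 ⊆ insert v S) (hφ : IsSetCode S v φ j) (hψ : IsSetCode S v ψ j)
    (h : ∀ x ∈ S \ recoveredSet v j, φ x = ψ x) : ∀ x ∈ recoveredSet v j, φ x = ψ x := by
  obtain ⟨⟨P, Q⟩, D, r⟩ := j
  obtain ⟨hQP, hDφ, heφ, hrφ⟩ := hφ
  obtain ⟨-, hDψ, heψ, hrψ⟩ := hψ
  dsimp only at hvP hPQ hQP hDφ heφ hrφ hDψ heψ hrψ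
  have hQPS : Q \ P ⊆ S := (subset_insert_iff_of_notMem (by simp [hvP])).1 hQP
  have hD := hDφ.symm.trans hDψ
  have hsub : ∀ x ∈ S, x ∈ Q → φ x = ψ x := by
    intro x hxS hxQ
    refine h x (mem_sdiff.2 ⟨hxS, ?_⟩)
    unfold recoveredSet
    split_ifs
    · have hxv : x ≠ v := ne_of_mem_of_not_mem hxS hvS
      simp [hxv, hxQ]
    · simp [hxQ]
  have hY : ∀ x ∈ Q \ P, φ x = ψ x := fun x hx => hsub x (hQPS hx) (mem_sdiff.1 hx).1
  have hZ : ∀ x ∈ P ∩ Q ∩ S, φ x = ψ x := fun x hx =>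
    hsub x (mem_inter.1 hx).2 (mem_inter.1 (mem_inter.1 hx).1).2
  by_cases hvQ : v ∈ Q
  · rw [if_pos hvQ] at hrφ hrψ
    have hwφ := minVertex_lowerColor hrφ.1 v
    have hwψ := minVertex_lowerColor hrψ.1 v
    rw [← hrφ.2] at hwφ
    rw [← hrψ.2] at hwψ
    have hPQS : P \ Q ⊆ S := (subset_insert_iff_of_notMem (by simp [hvQ])).1 hPQ
    have hw : φ (minVertex r v) = ψ (minVertex r v) := by
      refine h _ (mem_sdiff.2 ⟨hPQS hwφ.1, ?_⟩)
      simp only [recoveredSet, if_pos hvQ, mem_insert, mem_erase, not_or]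
      exact ⟨ne_of_mem_of_not_mem (hPQS hwφ.1) hvS, fun h => h.1 rfl⟩
    have hv : φ v = ψ v := by rw [← hwφ.2, ← hwψ.2, hw]
    have hfun := eq_of_range_eq_of_ofFun_eq
      (range_coe_eq_of_mem_image_iff (X := P \ Q) (f := lowerColor (φ v) φ)
        (g := lowerColor (φ v) ψ) fun d => ?_)
      (hrφ.2.symm.trans (by rw [hrψ.2, hv]))
    · intro x hx
      simp only [recoveredSet, if_pos hvQ] at hx
      rcases mem_insert.1 hx with rfl | hx
      · exact hv
      · exact lowerColor_injective (congrFun hfun ⟨x, (mem_erase.1 hx).2⟩)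
    · cases d with
      | zero =>
        exact iff_of_true (zero_mem_image_lowerColor hrφ.1)
          (zero_mem_image_lowerColor (hv ▸ hrψ.1))
      | succ d =>
        rw [succ_mem_image_lowerColor, succ_mem_image_lowerColor]
        refine and_congr_right fun hd => ?_
        exact mem_image_congr_of_union (mem_image_sdiff_or_iff hPQ hQP heφ fun _ => hd)
          (mem_image_sdiff_or_iff hPQ hQP heψ fun _ => hv ▸ hd) hD hY hZ
  · rw [if_neg hvQ] at hrφ hrψ
    have hfun := eq_of_range_eq_of_ofFun_eq
      (range_coe_eq_of_mem_image_iff (X := P \ Q) (f := φ) (g := ψ) fun d =>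
        mem_image_congr_of_union
          (mem_image_sdiff_or_iff hPQ hQP heφ fun h => (hvQ (mem_inter.1 h).2).elim)
          (mem_image_sdiff_or_iff hPQ hQP heψ fun h => (hvQ (mem_inter.1 h).2).elim) hD hY hZ)
      (hrφ.symm.trans hrψ)
    intro x hx
    simp only [recoveredSet, if_neg hvQ] at hx
    exact congrFun hfun ⟨x, hx⟩

/-- List colorings distinguishing intersecting edges by sets. A conflict of `P`, `Q` at `v` with
`#(P \ Q) = i` has `2 ^ (k - i) * f i` codes; the two kinds of pairs, with `v ∈ P \ Q` and with
`v ∈ P ∩ Q`, obey the same bound on their number, which makes for the factor `2 ^ (k - i + 1)`. -/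
theorem exists_setGood {V : Type*} [DecidableEq V] (W : Finset V) (E : Finset (Finset V))
    (k Δ R : ℕ) (hunif : ∀ P ∈ E, #P = k) (hdeg : ∀ v, #{P ∈ E | v ∈ P} ≤ Δ)
    (L : V → Finset ℕ) (hL : ∀ v ∈ W, R ≤ #(L v))
    (I : Finset ℕ) (hI : ∀ i ∈ I, 1 ≤ i ∧ i < k)
    (hEI : ∀ p ∈ intersectingPairs E, #(p.1 \ p.2) ∈ I)
    (hR : 2 + ∑ i ∈ I, qConst i * ithRoot i
      ((Δ : ℝ) * ((Δ : ℝ) - 1) * ((k : ℝ) - 1) / ((k : ℝ) - (i : ℝ)) *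
        2 ^ (k - i + 1) * (fubiniNumber i : ℝ)) ≤ R) :
    ∃ φ : V → ℕ, (∀ v ∈ W, φ v ∈ L v) ∧ SetGood E W φ := by
  have hcount : ∀ v : V, ∀ i ∈ I, _ := fun v i hi =>
    card_pairs_mem_sdiff_le hunif hdeg v (hI i hi).2
  rcases isEmpty_or_nonempty V with hV | ⟨⟨v₀⟩⟩
  · refine ⟨fun _ => 0, fun v => (hV.false v).elim, fun P _ Q _ hPQ => (hPQ ?_).elim⟩
    exact Subsingleton.elim _ _
  have hN : ∀ i ∈ I, 0 ≤ (Δ : ℝ) * ((Δ : ℝ) - 1) * ((k : ℝ) - 1) / ((k : ℝ) - (i : ℝ)) *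
      2 ^ (k - i + 1) * (fubiniNumber i : ℝ) := fun i hi =>
    mul_nonneg (mul_nonneg ((Nat.cast_nonneg _).trans (hcount v₀ i hi)) (by positivity))
      (Nat.cast_nonneg _)
  refine exists_good_listColoring_of_pairs W L R hL (SetGood E) ?_
    (fun S S' φ hS => SetGood.mono hS) ?_ I (fun i hi => (hI i hi).1) _ hN hR
    (fun v => {p ∈ intersectingPairs E | v ∈ p.1})
    (fun v _ p hp => hEI p (mem_filter.1 hp).1) SetCode ?_
    recoveredSet ?_
    (fun S v φ j => j.1.1 \ j.1.2 ⊆ insert v S ∧ IsSetCode S v φ j) ?_ ?_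
  · intro S φ ψ h hφ P hP Q hQ hne hint h1 h2
    have hc : ∀ A : Finset V, (A ∩ S).image ψ = (A ∩ S).image φ := fun A =>
      image_congr fun x hx => (h x (mem_inter.1 hx).2).symm
    rw [hc, hc]
    exact hφ P hP Q hQ hne hint h1 h2
  · intro φ P hP Q hQ hne _ h1 h2 _
    exact hne ((sdiff_eq_empty_iff_subset.1 (subset_empty.1 h1)).antisymm
      (sdiff_eq_empty_iff_subset.1 (subset_empty.1 h2)))
  · intro v _ i hi
    obtain ⟨hi1, hik⟩ := hI i hi
    rw [filter_filter]
    have hcard : ∀ p ∈ ({p ∈ intersectingPairs E | v ∈ p.1 ∧ #(p.1 \ p.2) = i} : Finset _),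
        (Fintype.card (SetCode p) : ℝ) = 2 ^ (k - i) * (fubiniNumber i : ℝ) := by
      intro p hp
      obtain ⟨h1, -, h2⟩ := mem_filter.1 hp
      have h3 := card_inter_add_card_sdiff p.1 p.2
      rw [hunif _ (mem_intersectingPairs.1 h1).1, h2] at h3
      rw [card_setCode, h2, ← h3, Nat.add_sub_cancel]
      push_cast; rfl
    rw [sum_congr rfl hcard, sum_const, nsmul_eq_mul]
    have hsplit : #{p ∈ intersectingPairs E | v ∈ p.1 ∧ #(p.1 \ p.2) = i} ≤
        #{p ∈ intersectingPairs E | v ∈ p.1 \ p.2 ∧ #(p.1 \ p.2) = i} +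
          #{p ∈ intersectingPairs E | v ∈ p.1 ∩ p.2} := by
      refine (card_le_card fun p hp => ?_).trans (card_union_le _ _)
      simp only [mem_union, mem_filter, mem_sdiff, mem_inter] at hp ⊢
      tauto
    have hsplit' : (#{p ∈ intersectingPairs E | v ∈ p.1 ∧ #(p.1 \ p.2) = i} : ℝ) ≤
        #{p ∈ intersectingPairs E | v ∈ p.1 \ p.2 ∧ #(p.1 \ p.2) = i} +
          #{p ∈ intersectingPairs E | v ∈ p.1 ∩ p.2} := by exact_mod_cast hsplit
    have hc1 := hcount v i hi
    have hc2 := card_pairs_mem_inter_le_div (k := k) hdeg v hi1 hik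
    rw [pow_succ']
    set N := (Δ : ℝ) * ((Δ : ℝ) - 1) * ((k : ℝ) - 1) / ((k : ℝ) - (i : ℝ))
    calc _ ≤ (2 * N) * (2 ^ (k - i) * (fubiniNumber i : ℝ)) := by
          gcongr; linarith
      _ = _ := by ring
  · intro v _ j hj
    obtain ⟨h1, h2⟩ := mem_filter.1 hj
    unfold recoveredSet
    split_ifs with h
    · refine ⟨mem_insert_self _ _, ?_⟩
      rw [card_insert_of_notMem (by simp [h])]
      have := pred_card_le_card_erase (s := j.1.1 \ j.1.2) (a := minVertex j.2.2 v)
      omega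
    · exact ⟨mem_sdiff.2 ⟨h2, h⟩, le_rfl⟩
  · intro S _ v _ hvS φ hg hb
    obtain ⟨j, h1, h2, h3⟩ := exists_isSetCode hg hb
    refine ⟨j, h1, ?_, h2, h3⟩
    unfold recoveredSet
    split_ifs
    · exact insert_subset (mem_insert_self _ _) ((erase_subset _ _).trans h2)
    · exact h2
  · rintro S _ v _ hvS j hj _ φ ψ ⟨hPQ, hφ⟩ ⟨_, hψ⟩ h
    exact hφ.eq_on_recoveredSet hvS (mem_filter.1 hj).2 hPQ hψ h

/-! ### From hypergraphs to finsets of edges -/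

open Classical in
/-- The edges of a hypergraph with finite vertex set, as a finset of finsets. -/
noncomputable def edgeFinsets {V : Type*} (H : Hypergraph V) (hfin : H.vertexSet.Finite) :
    Finset (Finset V) :=
  {P ∈ hfin.toFinset.powerset | (P : Set V) ∈ H.edgeSet}

theorem mem_edgeFinsets {V : Type*} {H : Hypergraph V} (hfin : H.vertexSet.Finite)
    {P : Finset V} : P ∈ edgeFinsets H hfin ↔ (P : Set V) ∈ H.edgeSet := by
  classical
  simp only [edgeFinsets, mem_filter, mem_powerset, and_iff_right_iff_imp]
  intro h x hx
  exact hfin.mem_toFinset.2 (H.subset_vertexSet_of_mem_edgeSet' h hx)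

theorem exists_mem_edgeFinsets {V : Type*} {H : Hypergraph V} (hfin : H.vertexSet.Finite)
    {P : Set V} (hP : P ∈ H.edgeSet) : ∃ P' ∈ edgeFinsets H hfin, (P' : Set V) = P :=
  have hf : P.Finite := hfin.subset (H.subset_vertexSet_of_mem_edgeSet' hP)
  ⟨hf.toFinset, (mem_edgeFinsets hfin).2 (by simpa using hP), hf.coe_toFinset⟩

theorem card_of_mem_edgeFinsets {V : Type*} {H : Hypergraph V} (hfin : H.vertexSet.Finite)
    {k : ℕ} (hunif : H.IsUniformHypergraph k) : ∀ P ∈ edgeFinsets H hfin, #P = k := by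
  intro P hP
  have := hunif P ((mem_edgeFinsets hfin).1 hP)
  rw [Set.encard_coe_eq_coe_finsetCard] at this
  exact_mod_cast this

theorem card_edgeFinsets_through_le {V : Type*} [DecidableEq V] {H : Hypergraph V}
    (hfin : H.vertexSet.Finite) {Δ : ℕ} (hdeg : H.maxVertexDegree ≤ Δ) (v : V) :
    #{P ∈ edgeFinsets H hfin | v ∈ P} ≤ Δ := by
  by_cases hv : v ∈ H.vertexSet
  · have h1 : H.vertexDegree v ≤ Δ := (le_iSup₂ (f := fun v _ => H.vertexDegree v) v hv).trans hdeg
    have h2 : (((↑) : Finset V → Set V) ''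
        ({P ∈ edgeFinsets H hfin | v ∈ P} : Finset (Finset V))) ⊆
        {P : Set V | P ∈ H.edgeSet ∧ v ∈ P} := by
      rintro _ ⟨P, hP, rfl⟩
      obtain ⟨h3, h4⟩ := mem_filter.1 (mem_coe.1 hP)
      exact ⟨(mem_edgeFinsets hfin).1 h3, h4⟩
    have h3 := (Set.encard_le_encard h2).trans h1
    rw [coe_injective.encard_image, Set.encard_coe_eq_coe_finsetCard] at h3
    exact_mod_cast h3
  · rw [filter_false_of_mem]
    · simp
    · intro P hP hvP
      exact hv (H.subset_vertexSet_of_mem_edgeSet' ((mem_edgeFinsets hfin).1 hP) hvP)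

theorem mem_diffSizes {V : Type*} {H : Hypergraph V} {k i : ℕ} :
    i ∈ H.diffSizes k ↔ (1 ≤ i ∧ i ≤ k - 1) ∧
      ∃ P ∈ H.edgeSet, ∃ Q ∈ H.edgeSet, (P \ Q).encard = i := by
  simp [Hypergraph.diffSizes]

theorem card_sdiff_mem_diffSizes {V : Type*} [DecidableEq V] {H : Hypergraph V}
    (hfin : H.vertexSet.Finite) {k : ℕ} (hunif : H.IsUniformHypergraph k) :
    ∀ p ∈ intersectingPairs (edgeFinsets H hfin), #(p.1 \ p.2) ∈ H.diffSizes k := by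
  intro p hp
  obtain ⟨h1, h2, hne, hint⟩ := mem_intersectingPairs.1 hp
  have hcard := card_of_mem_edgeFinsets hfin hunif
  have hk := card_inter_add_card_sdiff p.1 p.2
  rw [hcard _ h1] at hk
  have hpos : 0 < #(p.1 \ p.2) := by
    refine card_pos.2 (sdiff_nonempty.2 fun h => hne (eq_of_subset_of_card_le h ?_))
    rw [hcard _ h1, hcard _ h2]
  have := hint.card_pos
  refine mem_diffSizes.2 ⟨⟨hpos, by omega⟩, p.1, (mem_edgeFinsets hfin).1 h1, p.2,
    (mem_edgeFinsets hfin).1 h2, ?_⟩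
  rw [← coe_sdiff, Set.encard_coe_eq_coe_finsetCard]

theorem one_le_and_lt_of_mem_diffSizes {V : Type*} {H : Hypergraph V} {k : ℕ} :
    ∀ i ∈ H.diffSizes k, 1 ≤ i ∧ i < k := by
  intro i hi
  have := (mem_diffSizes.1 hi).1
  omega

theorem theorem3p1 {V : Type*} (H : Hypergraph V) (hfin : H.vertexSet.Finite)
    (k Δ R : ℕ) (hk : 2 ≤ k) (hunif : H.IsUniformHypergraph k) (hdeg : H.maxVertexDegree ≤ Δ)
    (L : V → Finset ℕ) (hL : ∀ v ∈ H.vertexSet, R ≤ (L v).card) :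
    (⌈2 + ∑ i ∈ H.diffSizes k, qConst i * ithRoot i
          ((Δ : ℝ) * ((Δ : ℝ) - 1) * ((k : ℝ) - 1) / ((k : ℝ) - (i : ℝ)) *
            2 ^ (k - i + 1) * (fubiniNumber i : ℝ))⌉ ≤ (R : ℤ) →
      ∃ φ : V → ℕ, H.RespectsLists L φ ∧ H.IsIedsColoring φ) ∧
    (⌈2 + ∑ i ∈ H.diffSizes k, qConst i * ithRoot i
          ((Δ : ℝ) * ((Δ : ℝ) - 1) * ((k : ℝ) - 1) / ((k : ℝ) - (i : ℝ)) *
            (Nat.factorial i : ℝ))⌉ ≤ (R : ℤ) →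
      ∃ φ : V → ℕ, H.RespectsLists L φ ∧ H.IsIedmColoring φ) := by
  classical
  have hunif' := card_of_mem_edgeFinsets hfin hunif
  have hdeg' := card_edgeFinsets_through_le hfin hdeg
  have hEI := card_sdiff_mem_diffSizes hfin hunif
  have hL' : ∀ v ∈ hfin.toFinset, R ≤ #(L v) := fun v hv => hL v (hfin.mem_toFinset.1 hv)
  have hsub : ∀ P ∈ edgeFinsets H hfin, P ⊆ hfin.toFinset := fun P hP x hx =>
    hfin.mem_toFinset.2 (H.subset_vertexSet_of_mem_edgeSet' ((mem_edgeFinsets hfin).1 hP) hx)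
  constructor
  · intro hR
    obtain ⟨φ, hφL, hφ⟩ := exists_setGood hfin.toFinset (edgeFinsets H hfin) k Δ R hunif' hdeg'
      L hL' (H.diffSizes k) one_le_and_lt_of_mem_diffSizes hEI (by exact_mod_cast Int.ceil_le.1 hR)
    refine ⟨φ, fun v hv => hφL v (hfin.mem_toFinset.2 hv), ?_⟩
    intro P hP Q hQ hne hint heq
    obtain ⟨P, hPE, rfl⟩ := exists_mem_edgeFinsets hfin hP
    obtain ⟨Q, hQE, rfl⟩ := exists_mem_edgeFinsets hfin hQ
    refine hφ P hPE Q hQE (fun h => hne (by rw [h])) (by exact_mod_cast hint)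
      (sdiff_subset.trans (hsub P hPE)) (sdiff_subset.trans (hsub Q hQE)) ?_
    rw [inter_eq_left.2 (hsub P hPE), inter_eq_left.2 (hsub Q hQE)]
    exact_mod_cast heq
  · intro hR
    obtain ⟨φ, hφL, hφ⟩ := exists_multisetGood hfin.toFinset (edgeFinsets H hfin) k Δ R hunif'
      hdeg' L hL' (H.diffSizes k) one_le_and_lt_of_mem_diffSizes hEI
      (by exact_mod_cast Int.ceil_le.1 hR)
    refine ⟨φ, fun v hv => hφL v (hfin.mem_toFinset.2 hv), ?_⟩
    intro P Q hP hQ hne hint heq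
    have hPE := (mem_edgeFinsets hfin).2 hP
    have hQE := (mem_edgeFinsets hfin).2 hQ
    exact hφ P hPE Q hQE hne (by exact_mod_cast hint) (sdiff_subset.trans (hsub P hPE))
      (sdiff_subset.trans (hsub Q hQE)) (map_sdiff_val_eq heq)
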